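/- Let $\Gamma$ be a finite group acting by homeomorphisms on a nonempty compact metrizable space $X$, let $\rho$ be a continuous pseudometric on $X$ that is dynamically generating (for all $x\neq y$ in $X$ there is $g\in\Gamma$ with $\rho(gx,gy)>0$), and let $1\le p<\infty$. Notation. For a pseudometric space $(A,d)$ and $\varepsilon>0$, $S_\varepsilon(A,d)$ is the smallest cardinality of a subset $T\subseteq A$ such that every $x\in A$ satisfies $d(x,y)<\varepsilon$ for some $y\in T$. For $k\ge 1$, $1\le q<\infty$ and $x,y\in X^k$ put $$\rho_q(x,y)=\Big(\frac1k\sum_{j=1}^k\rho(x_j,y_j)^q\Big)^{1/q},\qquad \rho_{\Gamma,p,k}(x,y)=\Big(\frac{1}{|\Gamma|k}\sum_{g\in\Gamma}\sum_{j=1}^k\rho(gx_j,gy_j)^p\Big)^{1/p}.$$ A sofic approximation of $\Gamma$ is a sequence $\Sigma=(\sigma_i)$ of maps $\sigma_i:\Gamma\to\mathrm{Sym}(d_i)$, not necessarily homomorphisms, with $d_i\to\infty$, such that, as $i\to\infty$, $\frac1{d_i}|\{j:\sigma_i(g)\sigma_i(h)(j)=\sigma_i(gh)(j)\}|\to1$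 for all $g,h\in\Gamma$, and $\frac1{d_i}|\{j:\sigma_i(g)(j)\ne\sigma_i(h)(j)\}|\to1$ for all $g\neq h$. For finite $F\subseteq\Gamma$ and $\delta>0$, $\mathrm{Map}(\rho,F,\delta,\sigma_i)$ is the set of $\phi:\{1,\dots,d_i\}\to X$ with $\rho_2(\phi\circ\sigma_i(g),g\phi)<\delta$ for all $g\in F$. Put $$\mathrm{mdim}_{\Sigma,p}(X,\rho)=\liminf_{\varepsilon\to0^+}\ \inf_{F,\delta}\ \limsup_{i\to\infty}\frac{\log S_\varepsilon(\mathrm{Map}(\rho,F,\delta,\sigma_i),\rho_p)}{d_i\log(1/\varepsilon)}\in[-\infty,\infty],$$ with $\log 0=-\infty$, and let $\mathrm{mdim}_p(X,\rho)$ denote the common value of $\mathrm{mdim}_{\Sigma,p}(X,\rho)$ over all sofic approximations $\Sigma$ of $\Gamma$ (sofic approximations exist and the value does not depend on $\Sigma$). Then: (i) for every $\varepsilon>0$ the limit $\lim_{k\to\infty}\frac{\log S_\varepsilon(X^k,\rho_{\Gamma,p,k})}{k}$ exists as a real number and equals $\inf_{k\ge1}\frac{\log S_\varepsilon(X^k,\rho_{\Gamma,p,k})}{k}$;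 (ii) we have $$\mathrm{mdim}_p(X,\rho)=\frac1{|\Gamma|}\liminf_{\varepsilon\to0^+}\lim_{k\to\infty}\frac{\log S_\varepsilon(X^k,\rho_{\Gamma,p,k})}{k\log(1/\varepsilon)},$$ that is, $\mathrm{mdim}_{\Sigma,p}(X,\rho)$ equals the right-hand side for every sofic approximation $\Sigma$ of $\Gamma$ (both sides may be $+\infty$). -/

import Mathlib

open Filter Topology

noncomputable section

/-- The `ε`-covering number of `A` with respect to `dist`: the smallest cardinality of a subset
`T` of `A` such that every point of `A` is at distance less than `ε` from a point of `T`. -/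
def coveringNum {Y : Type*} (dist : Y → Y → ℝ) (A : Set Y) (ε : ℝ) : ℕ∞ :=
  sInf {n : ℕ∞ | ∃ T : Set Y, T ⊆ A ∧ (∀ x ∈ A, ∃ y ∈ T, dist x y < ε) ∧ T.encard = n}

/-- The logarithm of the `ε`-covering number (with `log 0 = -∞` and `log ∞ = ∞`). -/
def logCoveringNum {Y : Type*} (dist : Y → Y → ℝ) (A : Set Y) (ε : ℝ) : EReal :=
  ENNReal.log ((coveringNum dist A ε : ℕ∞) : ENNReal)

/-- The pseudometric `ρ` on `X` is dynamically generating for the action of `Γ`: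
distinct points are separated by some translate of `ρ`. -/
def DynamicallyGenerating (Γ : Type*) {X : Type*} [SMul Γ X] (ρ : PseudoMetric X ℝ) : Prop :=
  ∀ x y : X, x ≠ y → ∃ g : Γ, 0 < ρ (g • x) (g • y)

/-- The normalized `ℓ^p`-product pseudometric on `X^ι`:
`ρ_p(x,y) = ((1/|ι|) ∑_j ρ(x_j, y_j)^p)^{1/p}`. -/
def lpDist {X ι : Type*} [Fintype ι] (ρ : PseudoMetric X ℝ) (p : ℝ) (x y : ι → X) : ℝ :=
  ((1 / (Fintype.card ι : ℝ)) * ∑ j, (ρ (x j) (y j)) ^ p) ^ (1 / p)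

/-- For a finite group `Γ` acting on `X`, the pseudometric on `X^k` given by
`ρ_{Γ,p,k}(x,y)^p = (1/(|Γ| k)) ∑_g ∑_j ρ(g x_j, g y_j)^p`. -/
def groupLpDist (Γ : Type*) [Fintype Γ] {X : Type*} [SMul Γ X] (ρ : PseudoMetric X ℝ) (p : ℝ)
    (k : ℕ) (x y : Fin k → X) : ℝ :=
  ((1 / ((Fintype.card Γ : ℝ) * (k : ℝ))) *
    ∑ g : Γ, ∑ j, (ρ (g • x j) (g • y j)) ^ p) ^ (1 / p)

/-- The sequence of maps `σ_i : Γ → Sym(d_i)` (not necessarily homomorphisms) is a sofic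
approximation of `Γ`. -/
structure IsSoficApprox {Γ : Type*} [Group Γ] (d : ℕ → ℕ)
    (σ : ∀ i, Γ → Equiv.Perm (Fin (d i))) : Prop where
  tendsto_card : Tendsto d atTop atTop
  mul : ∀ g h : Γ, Tendsto
    (fun i => (Nat.card {j : Fin (d i) // σ i g (σ i h j) = σ i (g * h) j} : ℝ) / (d i : ℝ))
    atTop (𝓝 1)
  free : ∀ g h : Γ, g ≠ h → Tendsto
    (fun i => (Nat.card {j : Fin (d i) // σ i g j ≠ σ i h j} : ℝ) / (d i : ℝ))
    atTop (𝓝 1)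

/-- The microstate space `Map(ρ, F, δ, σ)`: all `φ : {1,…,n} → X` with
`ρ_2(φ ∘ σ(g), g φ) < δ` for every `g ∈ F`. -/
def soficMap {Γ X : Type*} [SMul Γ X] (ρ : PseudoMetric X ℝ) (F : Finset Γ) (δ : ℝ) {n : ℕ}
    (σ : Γ → Equiv.Perm (Fin n)) : Set (Fin n → X) :=
  {φ | ∀ g ∈ F, lpDist ρ 2 (fun j => φ (σ g j)) (fun j => g • φ j) < δ}

/-- The `p`-metric mean dimension of `(X, ρ)` along `Σ = (σ_i)`:
`liminf_{ε → 0} inf_{F, δ} limsup_i log S_ε(Map(ρ,F,δ,σ_i), ρ_p) / (d_i log(1/ε))`. -/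
def soficMdim {Γ X : Type*} [SMul Γ X] (ρ : PseudoMetric X ℝ) (p : ℝ) (d : ℕ → ℕ)
    (σ : ∀ i, Γ → Equiv.Perm (Fin (d i))) : EReal :=
  liminf (fun ε : ℝ => ⨅ (F : Finset Γ) (δ : ℝ) (_ : 0 < δ),
    limsup (fun i => logCoveringNum (lpDist ρ p) (soficMap ρ F δ (σ i)) ε /
      (((d i : ℝ) * Real.log (1 / ε) : ℝ) : EReal)) atTop) (𝓝[>] 0)

/-- `m` is the `p`-metric mean dimension `mdim_p(X, ρ)` of the action of `Γ`, that is, the common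
value of the `p`-metric mean dimensions along all sofic approximations of `Γ`. -/
def IsMdim (Γ : Type*) [Group Γ] {X : Type*} [SMul Γ X] (ρ : PseudoMetric X ℝ) (p : ℝ)
    (m : EReal) : Prop :=
  (∃ (d : ℕ → ℕ) (σ : ∀ i, Γ → Equiv.Perm (Fin (d i))), IsSoficApprox d σ) ∧
  ∀ (d : ℕ → ℕ) (σ : ∀ i, Γ → Equiv.Perm (Fin (d i))), IsSoficApprox d σ →
    soficMdim ρ p d σ = m

end

/-! ### Covering numbers -/

/-! Part (i) is Fekete's lemma. Concatenating nets of `X^k` and `X^l` gives a net of `X^(k+l)` at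
the same scale, so the logarithm of the covering number is subadditive in `k`
(`subadditive_groupLogCov`); compactness makes it finite.

For part (ii), a sofic approximation of a finite group is, up to a vanishing proportion of points, a
genuine free action: the points where all the multiplicativity and freeness conditions hold split
into free orbits of size `|Γ|`. Choosing one representative per orbit gives `k` points with `k / d →
1 / |Γ|`. Restricting a microstate to the representatives loses little, since on an orbit it is
nearly determined by equivariance; conversely, a point of `X^k` extends equivariantly to the free
orbits, and arbitrarily elsewhere. For large `i` this bounds the covering number of the microstate
space at scale `ε` above by that of `X^k` at scale `ε / 16`, for a suitable `δ`
(`exists_coveringNum_soficMap_le`), and below by that of `X^k` at scale `16 ε`, for every `F` and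
`δ` (`coveringNum_le_coveringNum_soficMap`). The factors 16 disappear after division by `log (1 /
ε)` (`liminf_comp_const_mul_div_log`), so both bounds have the same lower limit. -/

theorem coveringNum_le_encard {Y : Type*} {dist : Y → Y → ℝ} {A T : Set Y} {ε : ℝ} (hT : T ⊆ A)
    (h : ∀ x ∈ A, ∃ y ∈ T, dist x y < ε) : coveringNum dist A ε ≤ T.encard :=
  sInf_le ⟨T, hT, h, rfl⟩

theorem exists_encard_eq_coveringNum {Y : Type*} {dist : Y → Y → ℝ} {A : Set Y} {ε : ℝ}
    (h : ∀ x ∈ A, dist x x < ε) :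
    ∃ T : Set Y, T ⊆ A ∧ (∀ x ∈ A, ∃ y ∈ T, dist x y < ε) ∧
      T.encard = coveringNum dist A ε :=
  csInf_mem (s := {n : ℕ∞ | ∃ T : Set Y, T ⊆ A ∧ (∀ x ∈ A, ∃ y ∈ T, dist x y < ε) ∧
    T.encard = n}) ⟨_, A, subset_rfl, fun x hx => ⟨x, hx, h x hx⟩, rfl⟩

/-- Centres must lie in `A`, so each net point of `B` that is close to `f '' A` is replaced by one
point of `A` whose image is close to it; the other net points are discarded. The hypothesis `h`
stands in for the triangle inequality, and carries the whole comparison in both applications. -/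
theorem coveringNum_le_of_map {Y Z : Type*} {dist : Y → Y → ℝ} {dist' : Z → Z → ℝ} {A : Set Y}
    {B : Set Z} {ε ε' : ℝ} (f : Y → Z) (hf : Set.MapsTo f A B)
    (h : ∀ x ∈ A, ∀ y ∈ A, ∀ z ∈ B, dist' (f x) z < ε' → dist' (f y) z < ε' → dist x y < ε) :
    coveringNum dist A ε ≤ coveringNum dist' B ε' := by
  refine le_sInf ?_
  rintro _ ⟨T, hTB, hT, rfl⟩
  have hex : ∀ z : {z ∈ T | ∃ y ∈ A, dist' (f y) z < ε'}, ∃ y ∈ A, dist' (f y) z.1 < ε' :=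
    fun z => z.2.2
  choose c hcA hc using hex
  have hcover : coveringNum dist A ε ≤ (Set.range c).encard := by
    refine coveringNum_le_encard ?_ ?_
    · rintro _ ⟨z, rfl⟩
      exact hcA z
    · intro x hx
      obtain ⟨z, hz, hxz⟩ := hT _ (hf hx)
      exact ⟨_, ⟨⟨z, hz, x, hx, hxz⟩, rfl⟩, h x hx _ (hcA _) z (hTB hz) hxz (hc _)⟩
  refine hcover.trans ?_
  rw [← Set.image_univ]
  refine (Set.encard_image_le _ _).trans ?_
  rw [Set.encard_univ]
  change Set.encard {z ∈ T | ∃ y ∈ A, dist' (f y) z < ε'} ≤ _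
  exact Set.encard_le_encard fun z hz => hz.1

theorem one_le_coveringNum {Y : Type*} {dist : Y → Y → ℝ} {A : Set Y} {ε : ℝ} (hA : A.Nonempty) :
    1 ≤ coveringNum dist A ε := by
  refine le_sInf ?_
  rintro _ ⟨T, -, hT, rfl⟩
  obtain ⟨x, hx⟩ := hA
  obtain ⟨y, hy, -⟩ := hT x hx
  exact Set.one_le_encard_iff_nonempty.2 ⟨y, hy⟩

theorem logCoveringNum_mono {Y Z : Type*} {dist : Y → Y → ℝ} {dist' : Z → Z → ℝ} {A : Set Y}
    {B : Set Z} {ε ε' : ℝ} (h : coveringNum dist A ε ≤ coveringNum dist' B ε') :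
    logCoveringNum dist A ε ≤ logCoveringNum dist' B ε' :=
  ENNReal.log_monotone (ENat.toENNReal_mono h)

/-! ### Normalized `ℓ^p` distances -/

theorem rpow_mean_lt_iff {c S p ε : ℝ} (hc : 0 < c) (hS : 0 ≤ S) (hp : 0 < p) (hε : 0 < ε) :
    (1 / c * S) ^ (1 / p) < ε ↔ S < c * ε ^ p := by
  rw [one_div p, Real.rpow_inv_lt_iff_of_pos (by positivity) hε.le hp, one_div,
    inv_mul_lt_iff₀ hc]

section

variable {Γ X : Type*}

theorem sum_dist_rpow_nonneg {ι : Type*} [Fintype ι] (ρ : PseudoMetric X ℝ) (p : ℝ)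
    (x y : ι → X) : 0 ≤ ∑ j, ρ (x j) (y j) ^ p :=
  Finset.sum_nonneg fun _ _ => Real.rpow_nonneg (ρ.nonneg _ _) _

theorem lpDist_lt_iff {ι : Type*} [Fintype ι] [Nonempty ι] (ρ : PseudoMetric X ℝ) {p ε : ℝ}
    (hp : 0 < p) (hε : 0 < ε) (x y : ι → X) :
    lpDist ρ p x y < ε ↔ ∑ j, ρ (x j) (y j) ^ p < Fintype.card ι * ε ^ p :=
  rpow_mean_lt_iff (by exact_mod_cast Fintype.card_pos) (sum_dist_rpow_nonneg ρ p x y) hp hε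

variable [Group Γ] [Fintype Γ] [MulAction Γ X]

theorem sum_sum_dist_rpow_nonneg {ι : Type*} [Fintype ι] (ρ : PseudoMetric X ℝ) (p : ℝ)
    (x y : ι → X) : 0 ≤ ∑ g : Γ, ∑ j, ρ (g • x j) (g • y j) ^ p :=
  Finset.sum_nonneg fun _ _ => sum_dist_rpow_nonneg ρ p _ _

theorem groupLpDist_lt_iff (ρ : PseudoMetric X ℝ) {p ε : ℝ} (hp : 0 < p) (hε : 0 < ε) {k : ℕ}
    (hk : 0 < k) (x y : Fin k → X) :
    groupLpDist Γ ρ p k x y < ε ↔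
      ∑ g : Γ, ∑ j, ρ (g • x j) (g • y j) ^ p < Fintype.card Γ * k * ε ^ p :=
  rpow_mean_lt_iff (mul_pos (by exact_mod_cast Fintype.card_pos) (by exact_mod_cast hk))
    (sum_sum_dist_rpow_nonneg ρ p x y) hp hε

theorem groupLpDist_self (ρ : PseudoMetric X ℝ) {p : ℝ} (hp : 0 < p) (k : ℕ) (x : Fin k → X) :
    groupLpDist Γ ρ p k x x = 0 := by
  simp [groupLpDist, Real.zero_rpow hp.ne', Real.zero_rpow (inv_ne_zero hp.ne')]

theorem coveringNum_groupLpDist_add_le (ρ : PseudoMetric X ℝ) {p ε : ℝ} (hp : 0 < p) (hε : 0 < ε)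
    {k l : ℕ} (hk : 0 < k) (hl : 0 < l) :
    coveringNum (groupLpDist Γ ρ p (k + l)) Set.univ ε ≤
      coveringNum (groupLpDist Γ ρ p k) Set.univ ε *
        coveringNum (groupLpDist Γ ρ p l) Set.univ ε := by
  obtain ⟨S, -, hS, hSc⟩ := exists_encard_eq_coveringNum (dist := groupLpDist Γ ρ p k)
    (A := Set.univ) (ε := ε) fun x _ => by rwa [groupLpDist_self ρ hp]
  obtain ⟨T, -, hT, hTc⟩ := exists_encard_eq_coveringNum (dist := groupLpDist Γ ρ p l)
    (A := Set.univ) (ε := ε) fun x _ => by rwa [groupLpDist_self ρ hp]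
  rw [← hSc, ← hTc, ← Set.encard_prod]
  refine le_trans (coveringNum_le_encard (Set.subset_univ
    ((fun z : (Fin k → X) × (Fin l → X) => Fin.append z.1 z.2) '' S ×ˢ T)) ?_)
    (Set.encard_image_le _ _)
  intro x _
  obtain ⟨y, hy, hxy⟩ := hS (fun j => x (Fin.castAdd l j)) trivial
  obtain ⟨z, hz, hxz⟩ := hT (fun j => x (Fin.natAdd k j)) trivial
  refine ⟨_, ⟨(y, z), ⟨hy, hz⟩, rfl⟩, ?_⟩
  rw [groupLpDist_lt_iff ρ hp hε (by omega)]
  rw [groupLpDist_lt_iff ρ hp hε hk] at hxy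
  rw [groupLpDist_lt_iff ρ hp hε hl] at hxz
  simp only [Fin.sum_univ_add, Fin.append_left, Fin.append_right, Finset.sum_add_distrib]
  push_cast
  linarith

variable (Γ) in
/-- The logarithm of the covering number of `X^k` at scale `ε`, as a real number. -/
noncomputable def groupLogCov (ρ : PseudoMetric X ℝ) (p ε : ℝ) (k : ℕ) : ℝ :=
  (logCoveringNum (groupLpDist Γ ρ p k) Set.univ ε).toReal

theorem logCoveringNum_groupLpDist_nonneg [Nonempty X] (ρ : PseudoMetric X ℝ) (p ε : ℝ) (k : ℕ) :
    0 ≤ logCoveringNum (groupLpDist Γ ρ p k) Set.univ ε := by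
  rw [logCoveringNum, ENNReal.zero_le_log_iff]
  exact_mod_cast one_le_coveringNum Set.univ_nonempty

theorem groupLogCov_nonneg [Nonempty X] (ρ : PseudoMetric X ℝ) (p ε : ℝ) (k : ℕ) :
    0 ≤ groupLogCov Γ ρ p ε k :=
  EReal.toReal_nonneg (logCoveringNum_groupLpDist_nonneg ρ p ε k)

theorem bddBelow_groupLogCov_div [Nonempty X] (ρ : PseudoMetric X ℝ) (p ε : ℝ) :
    BddBelow (Set.range fun k : ℕ => groupLogCov Γ ρ p ε k / k) := by
  refine ⟨0, ?_⟩
  rintro _ ⟨k, rfl⟩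
  exact div_nonneg (groupLogCov_nonneg ρ p ε k) k.cast_nonneg

variable [TopologicalSpace X] [ContinuousConstSMul Γ X]

theorem continuous_groupLpDist_left (ρ : PseudoMetric X ℝ)
    (hρ : Continuous fun z : X × X => ρ z.1 z.2) {p : ℝ} (hp : 0 < p) (k : ℕ) (y : Fin k → X) :
    Continuous fun x => groupLpDist Γ ρ p k x y := by
  unfold groupLpDist
  refine Continuous.rpow_const (continuous_const.mul (continuous_finsetSum _ fun g _ =>
    continuous_finsetSum _ fun j _ => Continuous.rpow_const ?_ fun _ => Or.inr hp.le))
    fun _ => Or.inr (by positivity)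
  have h : Continuous fun x : Fin k → X => g • x j := (continuous_apply j).const_smul g
  exact hρ.comp (h.prodMk continuous_const)

variable [CompactSpace X]

theorem coveringNum_groupLpDist_ne_top (ρ : PseudoMetric X ℝ)
    (hρ : Continuous fun z : X × X => ρ z.1 z.2) {p ε : ℝ} (hp : 0 < p) (hε : 0 < ε) (k : ℕ) :
    coveringNum (groupLpDist Γ ρ p k) Set.univ ε ≠ ⊤ := by
  obtain ⟨t, ht⟩ := isCompact_univ.elim_finite_subcover
    (fun y : Fin k → X => {x | groupLpDist Γ ρ p k x y < ε})
    (fun y => isOpen_lt (continuous_groupLpDist_left ρ hρ hp k y) continuous_const)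
    (fun x _ => Set.mem_iUnion.2 ⟨x, by simpa [groupLpDist_self ρ hp] using hε⟩)
  refine ne_top_of_le_ne_top ?_ (coveringNum_le_encard (Set.subset_univ (t : Set (Fin k → X))) ?_)
  · simp
  · intro x hx
    simpa using ht hx

variable [Nonempty X]

theorem coe_groupLogCov (ρ : PseudoMetric X ℝ)
    (hρ : Continuous fun z : X × X => ρ z.1 z.2) {p ε : ℝ} (hp : 0 < p) (hε : 0 < ε) (k : ℕ) :
    (groupLogCov Γ ρ p ε k : EReal) = logCoveringNum (groupLpDist Γ ρ p k) Set.univ ε := by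
  refine EReal.coe_toReal ?_ ?_
  · rw [logCoveringNum, Ne, ENNReal.log_eq_top_iff, ENat.toENNReal_eq_top]
    exact coveringNum_groupLpDist_ne_top ρ hρ hp hε k
  · exact ne_bot_of_le_ne_bot (by simp) (logCoveringNum_groupLpDist_nonneg ρ p ε k)

theorem subadditive_groupLogCov (ρ : PseudoMetric X ℝ)
    (hρ : Continuous fun z : X × X => ρ z.1 z.2) {p ε : ℝ} (hp : 0 < p) (hε : 0 < ε) :
    Subadditive (groupLogCov Γ ρ p ε) := by
  intro k l
  -- For exponent 0 the normalizing factor degenerates, but subadditivity then only needs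
  -- nonnegativity.
  rcases Nat.eq_zero_or_pos k with rfl | hk
  · simpa using groupLogCov_nonneg ρ p ε 0
  rcases Nat.eq_zero_or_pos l with rfl | hl
  · simpa using groupLogCov_nonneg ρ p ε 0
  rw [← EReal.coe_le_coe_iff, EReal.coe_add, coe_groupLogCov ρ hρ hp hε, coe_groupLogCov ρ hρ hp hε,
    coe_groupLogCov ρ hρ hp hε, logCoveringNum, logCoveringNum, logCoveringNum,
    ← ENNReal.log_mul_add, ← ENat.toENNReal_mul]
  exact ENNReal.log_monotone
    (ENat.toENNReal_mono (coveringNum_groupLpDist_add_le ρ hp hε hk hl))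

end

/-! ### Lower limits in the extended reals -/

/-- Superadditivity-type bounds for products give only one inequality (`key`); the other is the same
bound applied to the weight `w⁻¹` and the sequence `w * a`. The lower limit may be infinite, hence
the work in `EReal`. -/
theorem EReal.liminf_coe_mul_of_tendsto {α : Type*} {f : Filter α} [f.NeBot] {a w : α → ℝ} {c : ℝ}
    (ha : ∀ᶠ x in f, 0 ≤ a x) (hw : Tendsto w f (𝓝 c)) (hc : 0 < c) :
    liminf (fun x => ((w x * a x : ℝ) : EReal)) f = c * liminf (fun x => (a x : EReal)) f := by
  have key : ∀ (b v : α → ℝ) (e : ℝ), (∀ᶠ x in f, 0 ≤ b x) → Tendsto v f (𝓝 e) → 0 < e →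
      e * liminf (fun x => (b x : EReal)) f ≤ liminf (fun x => ((v x * b x : ℝ) : EReal)) f := by
    intro b v e hb hv he
    have hv' : Tendsto (fun x => (v x : EReal)) f (𝓝 (e : EReal)) :=
      (continuous_coe_real_ereal.tendsto e).comp hv
    have hpos : ∀ᶠ x in f, 0 < v x := hv.eventually_const_lt he
    have := EReal.le_liminf_mul (f := f) (u := fun x => (v x : EReal))
      (v := fun x => (b x : EReal)) (hpos.mono fun x hx => EReal.coe_nonneg.2 hx.le)
      (hb.mono fun x hx => EReal.coe_nonneg.2 hx)
    rw [hv'.liminf_eq] at this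
    exact this
  have hpos : ∀ᶠ x in f, 0 < w x := hw.eventually_const_lt hc
  refine le_antisymm ?_ (key a w c ha hw hc)
  have h := key (fun x => w x * a x) (fun x => (w x)⁻¹) c⁻¹
    (by filter_upwards [ha, hpos] with x h1 h2 using mul_nonneg h2.le h1) (hw.inv₀ hc.ne')
    (inv_pos.2 hc)
  have heq : liminf (fun x => (((w x)⁻¹ * (w x * a x) : ℝ) : EReal)) f =
      liminf (fun x => (a x : EReal)) f :=
    liminf_congr (hpos.mono fun x hx => by rw [inv_mul_cancel_left₀ hx.ne'])
  rw [heq] at h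
  have h' := mul_le_mul_of_nonneg_left h (EReal.coe_nonneg.2 hc.le)
  rwa [← mul_assoc, ← EReal.coe_mul, mul_inv_cancel₀ hc.ne', EReal.coe_one, one_mul] at h'

theorem map_const_mul_nhdsGT_zero {c : ℝ} (hc : 0 < c) :
    map (fun x => c * x) (𝓝[>] (0 : ℝ)) = 𝓝[>] 0 := by
  have := (Homeomorph.mulLeft₀ c hc.ne').isOpenEmbedding.toIsEmbedding.map_nhdsWithin_eq
    (Set.Ioi 0) 0
  simpa [Set.image_mul_left_Ioi hc] using this

/-- Rescaling `ε` by a constant does not change lower limits normalized by `log (1 / ε)`. -/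
theorem liminf_comp_const_mul_div_log {u : ℝ → ℝ} (hu : ∀ ε, 0 < ε → 0 ≤ u ε) {b c : ℝ} (hb : 0 < b)
    (hc : 0 < c) :
    liminf (fun ε : ℝ => ((b * (u (c * ε) / Real.log (1 / ε)) : ℝ) : EReal)) (𝓝[>] 0) =
      b * liminf (fun ε : ℝ => ((u ε / Real.log (1 / ε) : ℝ) : EReal)) (𝓝[>] 0) := by
  have hlog : Tendsto (fun ε : ℝ => Real.log (1 / ε)) (𝓝[>] 0) atTop := by
    simpa only [one_div, Function.comp_def] using
      Real.tendsto_log_atTop.comp (tendsto_inv_nhdsGT_zero (𝕜 := ℝ))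
  have hlogpos : ∀ᶠ ε : ℝ in 𝓝[>] 0, 0 < Real.log (1 / ε) := hlog.eventually_gt_atTop 0
  have hposε : ∀ᶠ ε : ℝ in 𝓝[>] 0, 0 < ε := self_mem_nhdsWithin
  conv_rhs => rw [← map_const_mul_nhdsGT_zero hc]
  rw [← liminf_comp]
  have hlogc : Tendsto (fun ε : ℝ => Real.log (1 / (c * ε))) (𝓝[>] 0) atTop := by
    have : Tendsto (fun ε : ℝ => c * ε) (𝓝[>] 0) (𝓝[>] 0) := (map_const_mul_nhdsGT_zero hc).le
    exact hlog.comp this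
  have hlogcpos : ∀ᶠ ε : ℝ in 𝓝[>] 0, 0 < Real.log (1 / (c * ε)) := hlogc.eventually_gt_atTop 0
  -- The ratio of logarithms is `1 - log c / log (1 / ε)`, which tends to 1.
  have hw : Tendsto (fun ε : ℝ => b * (Real.log (1 / (c * ε)) / Real.log (1 / ε))) (𝓝[>] 0)
      (𝓝 b) := by
    have h1 : Tendsto (fun ε : ℝ => b * (1 - Real.log c / Real.log (1 / ε))) (𝓝[>] 0)
        (𝓝 (b * (1 - 0))) :=
      (tendsto_const_nhds.sub (hlog.const_div_atTop _)).const_mul b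
    rw [sub_zero, mul_one] at h1
    refine h1.congr' ?_
    filter_upwards [hlogpos, hposε] with ε h2 h3
    have : Real.log (1 / (c * ε)) = Real.log (1 / ε) - Real.log c := by
      simp only [one_div, Real.log_inv, Real.log_mul hc.ne' h3.ne']
      ring
    rw [this]
    field_simp
  have h := EReal.liminf_coe_mul_of_tendsto
    (a := fun ε : ℝ => u (c * ε) / Real.log (1 / (c * ε)))
    (by filter_upwards [hlogcpos, hposε] with ε h1 h2 using
      div_nonneg (hu _ (mul_pos hc h2)) h1.le) hw hb
  refine Eq.trans (liminf_congr ?_) h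
  filter_upwards [hlogpos, hlogcpos] with ε h1 h2
  congr 1
  field_simp

/-! ### Orbits of almost actions of finite groups -/

section

variable {Γ : Type*} [Group Γ]

/-- The point `j` behaves under the maps `σ g` like a point in a free orbit of `Γ`. -/
structure IsFreePoint {α : Type*} (σ : Γ → Equiv.Perm α) (j : α) : Prop where
  mul : ∀ g h, σ g (σ h j) = σ (g * h) j
  free : ∀ g h, g ≠ h → σ g j ≠ σ h j

namespace IsFreePoint

variable {α : Type*} {σ : Γ → Equiv.Perm α} {j : α}

theorem apply_one (hj : IsFreePoint σ j) : σ 1 j = j :=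
  (σ 1).injective (by rw [hj.mul, one_mul])

theorem apply (hj : IsFreePoint σ j) (g : Γ) : IsFreePoint σ (σ g j) where
  mul a b := by rw [hj.mul, hj.mul, hj.mul, mul_assoc]
  free a b hab := by
    rw [hj.mul, hj.mul]
    exact hj.free _ _ (by simpa using hab)

end IsFreePoint

/-- On free points `σ` is an honest free action, so being joined by some `σ g` is an equivalence
relation; one representative is taken from each class. Injectivity combines disjointness of classes
with freeness inside a class. -/
theorem exists_freePoint_representatives {n : ℕ} (σ : Γ → Equiv.Perm (Fin n)) :
    ∃ (k : ℕ) (r : Fin k → Fin n), (∀ m, IsFreePoint σ (r m)) ∧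
      Function.Injective (fun z : Γ × Fin k => σ z.1 (r z.2)) ∧
      ∀ j, IsFreePoint σ j → ∃ z : Γ × Fin k, σ z.1 (r z.2) = j := by
  let S : Setoid {j // IsFreePoint σ j} :=
    { r := fun i j => ∃ g, σ g i = j
      iseqv := by
        refine ⟨fun i => ⟨1, i.2.apply_one⟩, ?_, ?_⟩
        · rintro i j ⟨g, hg⟩
          exact ⟨g⁻¹, by rw [← hg, i.2.mul, inv_mul_cancel, i.2.apply_one]⟩
        · rintro i j l ⟨g, hg⟩ ⟨h, hh⟩
          exact ⟨h * g, by rw [← hh, ← hg, i.2.mul]⟩ }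
  let e := Finite.equivFin (Quotient S)
  refine ⟨_, fun m => (e.symm m).out.1, fun m => (e.symm m).out.2, ?_, ?_⟩
  · rintro ⟨g, m⟩ ⟨h, l⟩ hgh
    dsimp only at hgh
    have hml : m = l := by
      have h1 : e.symm m = e.symm l := by
        rw [← Quotient.out_equiv_out]
        refine ⟨h⁻¹ * g, ?_⟩
        rw [← (e.symm m).out.2.mul, hgh, (e.symm l).out.2.mul, inv_mul_cancel,
          (e.symm l).out.2.apply_one]
      exact e.symm.injective h1
    subst hml
    by_contra hne
    exact (e.symm m).out.2.free g h (fun hg => hne (by rw [hg])) hgh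
  · intro j hj
    obtain ⟨g, hg⟩ : S (Quotient.out (Quotient.mk S ⟨j, hj⟩)) ⟨j, hj⟩ := Quotient.mk_out (s := S) _
    exact ⟨(g, e (Quotient.mk S ⟨j, hj⟩)), by simpa using hg⟩

variable [Fintype Γ]

/-- Union bound: a point that is not free violates at least one of the finitely many conditions, and
each summand counts the violations of one condition. Finiteness of `Γ` is what makes the bound
useful. -/
theorem card_not_isFreePoint_le {n : ℕ} (σ : Γ → Equiv.Perm (Fin n)) :
    (Nat.card {j // ¬ IsFreePoint σ j} : ℝ) ≤
      ∑ g : Γ, ∑ h : Γ, ((n : ℝ) - Nat.card {j // σ g (σ h j) = σ (g * h) j}) +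
      ∑ g : Γ, ∑ h : Γ, open Classical in
        if g = h then 0 else ((n : ℝ) - Nat.card {j // σ g j ≠ σ h j}) := by
  classical
  have hcompl : ∀ (P : Fin n → Prop) [DecidablePred P], (n : ℝ) - Nat.card {j // P j} =
      ∑ j, if P j then (0 : ℝ) else 1 := by
    intro P _
    have h1 : ∑ j, (if P j then (1 : ℝ) else 0) = Nat.card {j // P j} := by
      simp [Fintype.card_subtype]
    have h2 : ∑ j : Fin n, (1 : ℝ) = n := by simp
    rw [← h1, ← h2, ← Finset.sum_sub_distrib]
    exact Finset.sum_congr rfl fun j _ => by split_ifs <;> simp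
  have hcard : (Nat.card {j // ¬ IsFreePoint σ j} : ℝ) =
      ∑ j, if IsFreePoint σ j then (0 : ℝ) else 1 := by
    simp [Fintype.card_subtype, Finset.sum_ite]
  have hnn : ∀ (P : Prop) [Decidable P], (0 : ℝ) ≤ if P then (0 : ℝ) else 1 := fun P _ => by split_ifs <;> simp
  have hnn' : ∀ (P Q : Prop) [Decidable P] [Decidable Q], (0 : ℝ) ≤ if P then (0 : ℝ) else if Q then 0 else 1 :=
    fun P Q _ _ => by split_ifs <;> simp
  have hswap : ∀ f : Γ → Γ → Fin n → ℝ,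
      ∑ g, ∑ h, ∑ j, f g h j = ∑ j, ∑ g, ∑ h, f g h j := by
    intro f
    rw [Finset.sum_congr rfl fun g _ => Finset.sum_comm, Finset.sum_comm]
  have hite : ∀ g h : Γ, (if g = h then 0 else ((n : ℝ) - Nat.card {j // σ g j ≠ σ h j})) =
      ∑ j, if g = h then (0 : ℝ) else if σ g j ≠ σ h j then 0 else 1 := by
    intro g h
    split_ifs
    · simp
    · exact hcompl _
  simp_rw [hite, hcompl]
  rw [hswap, hswap, ← Finset.sum_add_distrib, hcard]
  refine Finset.sum_le_sum fun j _ => ?_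
  have hA : 0 ≤ ∑ g : Γ, ∑ h : Γ, if σ g (σ h j) = σ (g * h) j then (0 : ℝ) else 1 :=
    Finset.sum_nonneg fun _ _ => Finset.sum_nonneg fun _ _ => hnn _
  have hB : 0 ≤ ∑ g : Γ, ∑ h : Γ, if g = h then (0 : ℝ) else if σ g j ≠ σ h j then 0 else 1 :=
    Finset.sum_nonneg fun _ _ => Finset.sum_nonneg fun _ _ => hnn' _ _
  by_cases hj : IsFreePoint σ j
  · rw [if_pos hj]
    exact add_nonneg hA hB
  rw [if_neg hj]
  by_cases hm : ∀ g h, σ g (σ h j) = σ (g * h) j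
  · have hf : ∃ g h, g ≠ h ∧ σ g j = σ h j := by
      by_contra! hcon
      exact hj ⟨hm, hcon⟩
    obtain ⟨g, h, hne, heq⟩ := hf
    refine le_add_of_nonneg_of_le hA ?_
    refine le_trans ?_ (Finset.single_le_sum
      (fun g _ => Finset.sum_nonneg fun h _ => hnn' (g = h) (σ g j ≠ σ h j)) (Finset.mem_univ g))
    refine le_trans ?_ (Finset.single_le_sum
      (fun h _ => hnn' (g = h) (σ g j ≠ σ h j)) (Finset.mem_univ h))
    simp [hne, heq]
  · push Not at hm
    obtain ⟨g, h, hne⟩ := hm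
    refine le_add_of_le_of_nonneg ?_ hB
    refine le_trans ?_ (Finset.single_le_sum
      (fun g _ => Finset.sum_nonneg fun h _ => hnn (σ g (σ h j) = σ (g * h) j))
      (Finset.mem_univ g))
    refine le_trans ?_ (Finset.single_le_sum
      (fun h _ => hnn (σ g (σ h j) = σ (g * h) j)) (Finset.mem_univ h))
    simp [hne]

theorem IsSoficApprox.tendsto_card_not_isFreePoint {d : ℕ → ℕ}
    {σ : ∀ i, Γ → Equiv.Perm (Fin (d i))} (hσ : IsSoficApprox d σ) :
    Tendsto (fun i => (Nat.card {j // ¬ IsFreePoint (σ i) j} : ℝ) / d i) atTop (𝓝 0) := by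
  classical
  have hd : ∀ᶠ i in atTop, (0 : ℝ) < d i :=
    (hσ.tendsto_card.eventually_gt_atTop 0).mono fun i hi => by exact_mod_cast hi
  have hcompl : ∀ c : ℕ → ℕ, Tendsto (fun i => (c i : ℝ) / d i) atTop (𝓝 1) →
      Tendsto (fun i => ((d i : ℝ) - c i) / d i) atTop (𝓝 0) := by
    intro c hc
    have h1 := hc.const_sub 1
    rw [sub_self] at h1
    refine h1.congr' (hd.mono fun i hi => ?_)
    field_simp
  have hlim : Tendsto (fun i =>
      ∑ g : Γ, ∑ h : Γ, ((d i : ℝ) - Nat.card {j // σ i g (σ i h j) = σ i (g * h) j}) / d i +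
      ∑ g : Γ, ∑ h : Γ,
        if g = h then 0 else ((d i : ℝ) - Nat.card {j // σ i g j ≠ σ i h j}) / d i) atTop
      (𝓝 (∑ g : Γ, ∑ h : Γ, 0 + ∑ g : Γ, ∑ h : Γ, 0)) := by
    refine Tendsto.add ?_ ?_ <;>
      refine tendsto_finsetSum _ fun g _ => tendsto_finsetSum _ fun h _ => ?_
    · exact hcompl _ (hσ.mul g h)
    · split_ifs with hgh
      · exact tendsto_const_nhds
      · exact hcompl _ (hσ.free g h hgh)
  simp only [Finset.sum_const_zero, add_zero] at hlim
  refine squeeze_zero (fun i => by positivity) (fun i => ?_) hlim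
  refine (div_le_div_of_nonneg_right (card_not_isFreePoint_le (σ i)) (Nat.cast_nonneg _)).trans
    (le_of_eq ?_)
  simp only [add_div, Finset.sum_div, ite_div, zero_div]

variable (Γ) in
-- Left translation on `Γ × Fin (i + 1)` is a true free action, so both proportions are exactly 1.
theorem exists_isSoficApprox :
    ∃ (d : ℕ → ℕ) (σ : ∀ i, Γ → Equiv.Perm (Fin (d i))), IsSoficApprox d σ := by
  let e : ∀ i : ℕ, Γ × Fin (i + 1) ≃ Fin (Fintype.card Γ * (i + 1)) := fun i =>
    ((Fintype.equivFin Γ).prodCongr (Equiv.refl _)).trans finProdFinEquiv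
  have hpos : ∀ i : ℕ, 0 < Fintype.card Γ * (i + 1) := fun i => Nat.mul_pos Fintype.card_pos i.succ_pos
  have hone : ∀ P : ∀ i, Fin (Fintype.card Γ * (i + 1)) → Prop, (∀ i j, P i j) →
      Tendsto (fun i => (Nat.card {j // P i j} : ℝ) / ((Fintype.card Γ * (i + 1) : ℕ) : ℝ)) atTop
        (𝓝 1) := by
    intro P hP
    refine tendsto_const_nhds.congr fun i => ?_
    have h1 : Nat.card {j // P i j} = Fintype.card Γ * (i + 1) := by
      rw [Nat.card_congr (Equiv.subtypeUnivEquiv (hP i)), Nat.card_eq_fintype_card, Fintype.card_fin]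
    rw [h1, div_self]
    exact_mod_cast (hpos i).ne'
  refine ⟨fun i => Fintype.card Γ * (i + 1), fun i g =>
    ((e i).symm.trans ((Equiv.mulLeft g).prodCongr (Equiv.refl _))).trans (e i), ?_, ?_, ?_⟩
  · refine tendsto_atTop_mono (fun i => ?_) tendsto_id
    exact i.le_succ.trans (Nat.le_mul_of_pos_left _ Fintype.card_pos)
  · exact fun g h => hone _ fun i j => by simp [Prod.map]
  · exact fun g h hgh => hone _ fun i j => by simpa [Prod.map] using hgh

open Classical in
/-- The points `r m` represent, without repetition, the free orbits of `σ` on `Fin n`. -/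
structure IsOrbitDecomposition {n k : ℕ} (σ : Γ → Equiv.Perm (Fin n)) (r : Fin k → Fin n) :
    Prop where
  isFreePoint : ∀ m, IsFreePoint σ (r m)
  injective : Function.Injective fun z : Γ × Fin k => σ z.1 (r z.2)
  card_eq : (Fintype.card Γ * k + Nat.card {j // ¬ IsFreePoint σ j} : ℝ) = n
  sum_eq : ∀ f : Fin n → ℝ, ∑ j, f j =
    ∑ g, ∑ m, f (σ g (r m)) + ∑ j : {j // ¬ IsFreePoint σ j}, f j

theorem exists_isOrbitDecomposition {n : ℕ} (σ : Γ → Equiv.Perm (Fin n)) :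
    ∃ (k : ℕ) (r : Fin k → Fin n), IsOrbitDecomposition σ r := by
  classical
  obtain ⟨k, r, hr, hinj, hsurj⟩ := exists_freePoint_representatives σ
  have hsum : ∀ f : Fin n → ℝ, ∑ j, f j =
        ∑ g, ∑ m, f (σ g (r m)) + ∑ j : {j // ¬ IsFreePoint σ j}, f j := by
    intro f
    rw [← Fintype.sum_subtype_add_sum_subtype (IsFreePoint σ) f, ← Fintype.sum_prod_type'
      (f := fun g m => f (σ g (r m)))]
    congr 1
    · symm
      refine Fintype.sum_bijective (fun z : Γ × Fin k => (⟨σ z.1 (r z.2), (hr z.2).apply z.1⟩ :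
        {j // IsFreePoint σ j})) ⟨?_, ?_⟩ _ _ fun _ => rfl
      · exact fun z w hzw => hinj (congrArg Subtype.val hzw)
      · rintro ⟨j, hj⟩
        obtain ⟨z, hz⟩ := hsurj j hj
        exact ⟨z, Subtype.ext hz⟩
  refine ⟨k, r, hr, hinj, ?_, fun f => by convert hsum f⟩
  have := hsum fun _ => 1
  simp at this
  simp [this]

end

/-! ### Comparison of microstate spaces with powers of `X` -/

/-- Microstates are defined by an `ℓ²` condition but covered in `ℓ^p`; this converts one into the
other for bounded distances, whatever `p` is. Below the threshold `η ^ (1 / p)` the term `η`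
suffices, above it the quadratic term does. -/
theorem Real.exists_rpow_le_add_mul_sq {p : ℝ} (hp : 0 < p) (D : ℝ) {η : ℝ} (hη : 0 < η) :
    ∃ C : ℝ, 0 < C ∧ ∀ t, 0 ≤ t → t ≤ D → t ^ p ≤ η + C * t ^ (2 : ℝ) := by
  set s := η ^ (1 / p)
  have hs : 0 < s := Real.rpow_pos_of_pos hη _
  refine ⟨|D| ^ p / s ^ (2 : ℝ) + 1, by positivity, fun t ht htD => ?_⟩
  have ht2 : 0 ≤ t ^ (2 : ℝ) := Real.rpow_nonneg ht _
  have hC : 0 ≤ |D| ^ p / s ^ (2 : ℝ) := by positivity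
  rcases le_total t s with h | h
  · have h1 : t ^ p ≤ s ^ p := Real.rpow_le_rpow ht h hp.le
    rw [← Real.rpow_mul hη.le, one_div_mul_cancel hp.ne', Real.rpow_one] at h1
    have h2 : 0 ≤ (|D| ^ p / s ^ (2 : ℝ) + 1) * t ^ (2 : ℝ) := by positivity
    linarith
  · have h1 : t ^ p ≤ |D| ^ p := Real.rpow_le_rpow ht (htD.trans (le_abs_self D)) hp.le
    have h2 : s ^ (2 : ℝ) ≤ t ^ (2 : ℝ) := Real.rpow_le_rpow hs.le h (by norm_num)
    have hs2 : 0 < s ^ (2 : ℝ) := by positivity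
    have h3 : |D| ^ p ≤ |D| ^ p / s ^ (2 : ℝ) * t ^ (2 : ℝ) := by
      calc |D| ^ p = |D| ^ p / s ^ (2 : ℝ) * s ^ (2 : ℝ) := by field_simp
        _ ≤ _ := mul_le_mul_of_nonneg_left h2 hC
    linarith

theorem Real.add_rpow_le_two_rpow_mul {p a b : ℝ} (hp : 0 < p) (ha : 0 ≤ a) (hb : 0 ≤ b) :
    (a + b) ^ p ≤ 2 ^ p * (a ^ p + b ^ p) := by
  have h2 : (0 : ℝ) ≤ 2 ^ p := by positivity
  rcases le_total a b with h | h
  · calc (a + b) ^ p ≤ (2 * b) ^ p := Real.rpow_le_rpow (by positivity) (by linarith) hp.le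
      _ = 2 ^ p * b ^ p := Real.mul_rpow (by norm_num) hb
      _ ≤ _ := mul_le_mul_of_nonneg_left (by linarith [Real.rpow_nonneg ha p]) h2
  · calc (a + b) ^ p ≤ (2 * a) ^ p := Real.rpow_le_rpow (by positivity) (by linarith) hp.le
      _ = 2 ^ p * a ^ p := Real.mul_rpow (by norm_num) ha
      _ ≤ _ := mul_le_mul_of_nonneg_left (by linarith [Real.rpow_nonneg hb p]) h2

theorem PseudoMetric.rpow_le_two_rpow_mul {X : Type*} (ρ : PseudoMetric X ℝ) {p : ℝ} (hp : 0 < p)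
    (x y z : X) : ρ x z ^ p ≤ 2 ^ p * (ρ x y ^ p + ρ y z ^ p) :=
  (Real.rpow_le_rpow (ρ.nonneg _ _) (ρ.triangle x y z) hp.le).trans
    (Real.add_rpow_le_two_rpow_mul hp (ρ.nonneg _ _) (ρ.nonneg _ _))

/-- Used along the chain `φ (σ g j)`, `g • φ j`, `g • z`, `g • ψ j`, `ψ (σ g j)`; the last two
distances are reversed to match the hypotheses on `ψ`. -/
theorem PseudoMetric.rpow_le_four_rpow_mul {X : Type*} (ρ : PseudoMetric X ℝ) {p : ℝ} (hp : 0 < p)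
    (a b c d e : X) :
    ρ a e ^ p ≤ 4 ^ p * (ρ a b ^ p + ρ b c ^ p + ρ d c ^ p + ρ e d ^ p) := by
  have h4 : (4 : ℝ) ^ p = 2 ^ p * 2 ^ p := by
    rw [← Real.mul_rpow (by norm_num) (by norm_num)]; norm_num
  have h2 : (0 : ℝ) < 2 ^ p := by positivity
  have h := ρ.rpow_le_two_rpow_mul hp a c e
  have h' := mul_le_mul_of_nonneg_left (ρ.rpow_le_two_rpow_mul hp a b c) h2.le
  have h'' := mul_le_mul_of_nonneg_left (ρ.rpow_le_two_rpow_mul hp c d e) h2.le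
  rw [ρ.symm c d, ρ.symm d e] at h''
  rw [h4]
  linarith

theorem PseudoMetric.exists_forall_le {X : Type*} [TopologicalSpace X] [CompactSpace X]
    (ρ : PseudoMetric X ℝ) (hρ : Continuous fun z : X × X => ρ z.1 z.2) :
    ∃ D : ℝ, 0 < D ∧ ∀ x y, ρ x y ≤ D := by
  obtain ⟨D, hD⟩ := isCompact_univ.bddAbove_image hρ.continuousOn
  exact ⟨max D 1, by positivity, fun x y =>
    (hD ⟨(x, y), trivial, rfl⟩).trans (le_max_left _ _)⟩

section

variable {Γ X : Type*} [Group Γ] [Fintype Γ] [MulAction Γ X]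

namespace IsOrbitDecomposition

variable {n k : ℕ} {σ : Γ → Equiv.Perm (Fin n)} {r : Fin k → Fin n}

theorem card_mul_le (h : IsOrbitDecomposition σ r) : (Fintype.card Γ * k : ℝ) ≤ n := by
  rw [← h.card_eq]
  exact le_add_of_nonneg_right (Nat.cast_nonneg _)

theorem sum_orbits_le (h : IsOrbitDecomposition σ r) {f : Fin n → ℝ} (hf : ∀ j, 0 ≤ f j) :
    ∑ g, ∑ m, f (σ g (r m)) ≤ ∑ j, f j := by
  rw [h.sum_eq]
  exact le_add_of_nonneg_right (Finset.sum_nonneg fun j _ => hf j)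

theorem sum_representatives_le (h : IsOrbitDecomposition σ r) {f : Fin n → ℝ}
    (hf : ∀ j, 0 ≤ f j) : ∑ m, f (r m) ≤ ∑ j, f j := by
  refine le_trans (le_of_eq ?_) ((Finset.single_le_sum (f := fun g => ∑ m, f (σ g (r m)))
    (fun g _ => Finset.sum_nonneg fun m _ => hf _) (Finset.mem_univ 1)).trans
    (h.sum_orbits_le hf))
  simp only [(h.isFreePoint _).apply_one]

theorem sum_le (h : IsOrbitDecomposition σ r) {f : Fin n → ℝ} {M : ℝ} (hf : ∀ j, f j ≤ M) :
    ∑ j, f j ≤ ∑ g, ∑ m, f (σ g (r m)) + Nat.card {j // ¬ IsFreePoint σ j} * M := by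
  classical
  rw [h.sum_eq]
  refine add_le_add le_rfl ((Finset.sum_le_card_nsmul _
    (fun j : {j // ¬ IsFreePoint σ j} => f j) M fun j _ => hf j).trans (le_of_eq ?_))
  simp [Fintype.card_subtype]

end IsOrbitDecomposition

/-- The inequality is not strict so as to include `k = 0`, where both sides vanish. -/
theorem sum_sum_dist_rpow_le (ρ : PseudoMetric X ℝ) {p ε : ℝ} (hp : 0 < p) (hε : 0 < ε) {k : ℕ}
    {x y : Fin k → X} (h : groupLpDist Γ ρ p k x y < ε) :
    ∑ g : Γ, ∑ j, ρ (g • x j) (g • y j) ^ p ≤ Fintype.card Γ * k * ε ^ p := by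
  rcases Nat.eq_zero_or_pos k with rfl | hk
  · simp
  · exact ((groupLpDist_lt_iff ρ hp hε hk x y).1 h).le

theorem exists_coveringNum_soficMap_le (ρ : PseudoMetric X ℝ) {D : ℝ} (hD : 0 < D)
    (hρD : ∀ x y, ρ x y ≤ D) {p ε : ℝ} (hp : 1 ≤ p) (hε : 0 < ε) :
    ∃ δ : ℝ, 0 < δ ∧ ∃ κ : ℝ, 0 < κ ∧ ∀ (n k : ℕ) (σ : Γ → Equiv.Perm (Fin n))
      (r : Fin k → Fin n), 0 < n → IsOrbitDecomposition σ r →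
      (Nat.card {j // ¬ IsFreePoint σ j} : ℝ) ≤ κ * n →
      coveringNum (lpDist ρ p) (soficMap ρ Finset.univ δ σ) ε ≤
        coveringNum (groupLpDist Γ ρ p k) Set.univ (1 / 16 * ε) := by
  have hp0 : 0 < p := by linarith
  set q : ℝ := 4 ^ p with hq
  have hq4 : 4 ≤ q := by
    simpa using Real.rpow_le_rpow_of_exponent_le (x := 4) (by norm_num) hp
  have hqq : (1 / 16 * ε) ^ p = ε ^ p / (q * q) := by
    rw [Real.mul_rpow (by norm_num) hε.le, Real.div_rpow (by norm_num) (by norm_num), hq,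
      ← Real.mul_rpow (by norm_num) (by norm_num), Real.one_rpow]
    norm_num
    ring
  have hN : (0 : ℝ) < Fintype.card Γ := by exact_mod_cast Fintype.card_pos
  have hεp : 0 < ε ^ p := Real.rpow_pos_of_pos hε p
  have hDp : 0 < D ^ p := Real.rpow_pos_of_pos hD p
  set η : ℝ := ε ^ p / (32 * q * Fintype.card Γ) with hηdef
  have hη : 0 < η := by positivity
  obtain ⟨C, hC, hCt⟩ := Real.exists_rpow_le_add_mul_sq hp0 D hη
  -- `δ` is chosen so that `C * δ ^ 2 = η`, and `κ` so that the non-free points contribute at most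
  -- `n * ε ^ p / 8`.
  refine ⟨(η / C) ^ (1 / (2 : ℝ)), by positivity, ε ^ p / (8 * D ^ p), by positivity, ?_⟩
  intro n k σ r hn hr hbad
  have : NeZero n := ⟨hn.ne'⟩
  have hn' : (0 : ℝ) < n := by exact_mod_cast hn
  have hδ : ((η / C) ^ (1 / (2 : ℝ))) ^ (2 : ℝ) = η / C := by
    rw [← Real.rpow_mul (by positivity), one_div_mul_cancel (by norm_num), Real.rpow_one]
  have hmap : ∀ φ ∈ soficMap ρ Finset.univ ((η / C) ^ (1 / (2 : ℝ))) σ,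
      ∑ g, ∑ m, ρ (φ (σ g (r m))) (g • φ (r m)) ^ p ≤ Fintype.card Γ * (2 * η * n) := by
    intro φ hφ
    rw [← nsmul_eq_mul, ← Finset.card_univ]
    refine Finset.sum_le_card_nsmul _ _ _ fun g _ => ?_
    refine (hr.sum_representatives_le (f := fun j => ρ (φ (σ g j)) (g • φ j) ^ p)
      fun j => Real.rpow_nonneg (ρ.nonneg _ _) _).trans ?_
    have h1 := (lpDist_lt_iff ρ (by norm_num) (by positivity) _ _).1 (hφ g (Finset.mem_univ g))
    rw [hδ, Fintype.card_fin] at h1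
    calc ∑ j, ρ (φ (σ g j)) (g • φ j) ^ p
        ≤ ∑ j, (η + C * ρ (φ (σ g j)) (g • φ j) ^ (2 : ℝ)) :=
          Finset.sum_le_sum fun j _ => hCt _ (ρ.nonneg _ _) (hρD _ _)
      _ = n * η + C * ∑ j, ρ (φ (σ g j)) (g • φ j) ^ (2 : ℝ) := by
          rw [Finset.sum_add_distrib, Finset.mul_sum]
          simp
      _ ≤ n * η + C * (n * (η / C)) := by gcongr
      _ = 2 * η * n := by field_simp; ring
  refine coveringNum_le_of_map (fun φ m => φ (r m)) (Set.mapsTo_univ _ _) ?_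
  intro φ hφ ψ hψ z _ hφz hψz
  have h1 := sum_sum_dist_rpow_le ρ hp0 (by positivity) hφz
  have h2 := sum_sum_dist_rpow_le ρ hp0 (by positivity) hψz
  have h3 := hmap φ hφ
  have h4 := hmap ψ hψ
  rw [lpDist_lt_iff ρ hp0 hε, Fintype.card_fin]
  have hmain : ∑ g, ∑ m, ρ (φ (σ g (r m))) (ψ (σ g (r m))) ^ p ≤
      q * (∑ g, ∑ m, ρ (φ (σ g (r m))) (g • φ (r m)) ^ p +
        ∑ g : Γ, ∑ m, ρ (g • φ (r m)) (g • z m) ^ p +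
        ∑ g : Γ, ∑ m, ρ (g • ψ (r m)) (g • z m) ^ p +
        ∑ g, ∑ m, ρ (ψ (σ g (r m))) (g • ψ (r m)) ^ p) := by
    simp only [← Finset.sum_add_distrib, Finset.mul_sum]
    exact Finset.sum_le_sum fun g _ => Finset.sum_le_sum fun m _ =>
      ρ.rpow_le_four_rpow_mul hp0 _ _ _ _ _
  have hk := hr.card_mul_le
  have h5 : (Fintype.card Γ * k : ℝ) * (1 / 16 * ε) ^ p ≤ n * (ε ^ p / (q * q)) := by
    rw [hqq]; gcongr
  have h6 : (Nat.card {j // ¬ IsFreePoint σ j} : ℝ) * D ^ p ≤ n * ε ^ p / 8 := by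
    calc _ ≤ ε ^ p / (8 * D ^ p) * n * D ^ p := by gcongr
      _ = _ := by field_simp
  -- Error budget in units of `n * ε ^ p`: 1/8 from the two equivariance defects, `2 / q ≤ 1/2` from
  -- the two distances to the net point. With 1/8 from the non-free points the total is 3/4, which
  -- is below 1.
  have h7 : q * (2 * (Fintype.card Γ * (2 * η * n)) + 2 * (n * (ε ^ p / (q * q)))) ≤
      n * ε ^ p * (5 / 8) := by
    have h8 : q * (2 * (Fintype.card Γ * (2 * η * n)) + 2 * (n * (ε ^ p / (q * q)))) =
        n * ε ^ p * (1 / 8 + 2 / q) := by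
      rw [hηdef]; field_simp; ring
    rw [h8]
    have h9 : 2 / q ≤ 1 / 2 := by rw [div_le_div_iff₀ (by linarith) (by norm_num)]; linarith
    exact mul_le_mul_of_nonneg_left (by linarith) (by positivity)
  have h10 := hr.sum_le (f := fun j => ρ (φ j) (ψ j) ^ p) (M := D ^ p)
    fun j => Real.rpow_le_rpow (ρ.nonneg _ _) (hρD _ _) hp0.le
  have h11 := hmain.trans (mul_le_mul_of_nonneg_left (b := _)
    (c := 2 * (Fintype.card Γ * (2 * η * n)) + 2 * (n * (ε ^ p / (q * q))))
    (by linarith) (by linarith : (0 : ℝ) ≤ q))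
  have h12 : 0 < n * ε ^ p := by positivity
  linarith

theorem coveringNum_le_coveringNum_soficMap [Nonempty X] (ρ : PseudoMetric X ℝ) {D : ℝ}
    (hρD : ∀ x y, ρ x y ≤ D) {p ε δ : ℝ} (hp : 1 ≤ p) (hε : 0 < ε) (hδ : 0 < δ) (F : Finset Γ)
    {n k : ℕ} {σ : Γ → Equiv.Perm (Fin n)} {r : Fin k → Fin n} (hn : 0 < n)
    (hr : IsOrbitDecomposition σ r)
    (hbad : Nat.card {j // ¬ IsFreePoint σ j} * D ^ (2 : ℝ) < n * δ ^ (2 : ℝ))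
    (hk : (n : ℝ) ≤ 2 * (Fintype.card Γ * k)) :
    coveringNum (groupLpDist Γ ρ p k) Set.univ (16 * ε) ≤
      coveringNum (lpDist ρ p) (soficMap ρ F δ σ) ε := by
  have hp0 : 0 < p := by linarith
  have : NeZero n := ⟨hn.ne'⟩
  have hn' : (0 : ℝ) < n := by exact_mod_cast hn
  have hk0 : 0 < k := by
    rcases Nat.eq_zero_or_pos k with rfl | h
    · simp only [Nat.cast_zero, mul_zero] at hk
      linarith
    · exact h
  obtain ⟨x₀⟩ := ‹Nonempty X›
  -- The extension is exactly equivariant on the free orbits and constant on the rest, so its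
  -- equivariance defect comes from non-free points alone.
  set E : (Fin k → X) → Fin n → X := fun x =>
    Function.extend (fun z : Γ × Fin k => σ z.1 (r z.2)) (fun z => z.1 • x z.2) fun _ => x₀
  have hE : ∀ x g m, E x (σ g (r m)) = g • x m := fun x g m =>
    hr.injective.extend_apply (fun z : Γ × Fin k => z.1 • x z.2) (fun _ => x₀) (g, m)
  refine coveringNum_le_of_map E ?_ ?_
  · intro x _ g _
    rw [lpDist_lt_iff ρ (by norm_num) hδ, Fintype.card_fin]
    refine lt_of_le_of_lt (hr.sum_le (f := fun j => ρ (E x (σ g j)) (g • E x j) ^ (2 : ℝ))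
      (M := D ^ (2 : ℝ))
      fun j => Real.rpow_le_rpow (ρ.nonneg _ _) (hρD _ _) (by norm_num)) ?_
    have hzero : ∀ h m, ρ (E x (σ g (σ h (r m)))) (g • E x (σ h (r m))) ^ (2 : ℝ) = 0 := by
      intro h m
      rw [(hr.isFreePoint m).mul, hE, hE, mul_smul, ρ.refl, Real.zero_rpow (by norm_num)]
    simpa only [hzero, Finset.sum_const_zero, zero_add] using hbad
  · intro x _ y _ z _ hxz hyz
    rw [lpDist_lt_iff ρ hp0 hε, Fintype.card_fin] at hxz hyz
    rw [groupLpDist_lt_iff ρ hp0 (by positivity) hk0]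
    have h1 := hr.sum_orbits_le (f := fun j => ρ (E x j) (E y j) ^ p)
      fun j => Real.rpow_nonneg (ρ.nonneg _ _) _
    simp only [hE] at h1
    have h2 : ∑ j, ρ (E x j) (E y j) ^ p ≤
        2 ^ p * (∑ j, ρ (E x j) (z j) ^ p + ∑ j, ρ (E y j) (z j) ^ p) := by
      rw [← Finset.sum_add_distrib, Finset.mul_sum]
      refine Finset.sum_le_sum fun j _ => ?_
      rw [ρ.symm (E y j) (z j)]
      exact ρ.rpow_le_two_rpow_mul hp0 _ _ _
    have h2p : (0 : ℝ) < 2 ^ p := by positivity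
    have hεp : 0 < ε ^ p := Real.rpow_pos_of_pos hε p
    -- The scale 16 is 2 from the triangle inequality times 8, where `8 ^ p ≥ 8` absorbs the factor
    -- 4 due to the two net distances and to `n ≤ 2 * |Γ| * k`.
    have h8 : (8 : ℝ) ≤ 8 ^ p := by
      simpa using Real.rpow_le_rpow_of_exponent_le (x := 8) (by norm_num) hp
    have h16 : (16 * ε) ^ p = 2 ^ p * 8 ^ p * ε ^ p := by
      rw [← Real.mul_rpow (by norm_num) (by norm_num), ← Real.mul_rpow (by norm_num) hε.le]
      norm_num
    calc ∑ g : Γ, ∑ j, ρ (g • x j) (g • y j) ^ p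
        ≤ 2 ^ p * (∑ j, ρ (E x j) (z j) ^ p + ∑ j, ρ (E y j) (z j) ^ p) := h1.trans h2
      _ < 2 ^ p * (n * ε ^ p + n * ε ^ p) := by gcongr
      _ = n * (2 ^ p * 2 * ε ^ p) := by ring
      _ ≤ 2 * (Fintype.card Γ * k) * (2 ^ p * 2 * ε ^ p) := by gcongr
      _ = Fintype.card Γ * k * (2 ^ p * 4 * ε ^ p) := by ring
      _ ≤ Fintype.card Γ * k * (2 ^ p * 8 ^ p * ε ^ p) := by gcongr; linarith
      _ = _ := by rw [h16]

end

/-! ### Metric mean dimension along a sofic approximation -/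

section

variable {Γ X : Type*} [Group Γ] [Fintype Γ] [MulAction Γ X]

/-- Changes the normalization from the number of orbits to the number of points, by writing the
quotient as `k / d` times the quotient by `k`. -/
theorem tendsto_groupLogCov_div_comp (ρ : PseudoMetric X ℝ) {p : ℝ} {d : ℕ → ℕ}
    (hd : Tendsto d atTop atTop) {ε c ℓ : ℝ}
    (hL : Tendsto (fun k : ℕ => groupLogCov Γ ρ p ε k / k) atTop (𝓝 ℓ)) {k : ℕ → ℕ}
    (hk : Tendsto k atTop atTop)
    (hkd : Tendsto (fun i => (k i : ℝ) / d i) atTop (𝓝 (1 / Fintype.card Γ))) :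
    Tendsto (fun i => ((groupLogCov Γ ρ p ε (k i) : ℝ) : EReal) / ((d i * c : ℝ) : EReal)) atTop
      (𝓝 ((1 / Fintype.card Γ * (ℓ / c) : ℝ) : EReal)) := by
  simp only [← EReal.coe_div]
  refine (continuous_coe_real_ereal.tendsto _).comp ?_
  have h := hkd.mul ((hL.comp hk).div_const c)
  refine h.congr' ?_
  filter_upwards [hk.eventually_gt_atTop 0, hd.eventually_gt_atTop 0] with i h1 h2
  have h1' : (0 : ℝ) < k i := by exact_mod_cast h1
  have h2' : (0 : ℝ) < d i := by exact_mod_cast h2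
  simp only [Function.comp_apply]
  field_simp

variable [TopologicalSpace X] [CompactSpace X] [Nonempty X] [ContinuousConstSMul Γ X]

theorem exists_tendsto_groupLogCov_div (ρ : PseudoMetric X ℝ)
    (hρ : Continuous fun z : X × X => ρ z.1 z.2) {p ε : ℝ} (hp : 0 < p) (hε : 0 < ε) :
    ∃ L : ℝ, 0 ≤ L ∧ Tendsto (fun k : ℕ => groupLogCov Γ ρ p ε k / k) atTop (𝓝 L) ∧
      ∀ k : ℕ, 1 ≤ k → L ≤ groupLogCov Γ ρ p ε k / k := by
  have hsub := subadditive_groupLogCov (Γ := Γ) ρ hρ hp hε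
  have hbdd := bddBelow_groupLogCov_div (Γ := Γ) ρ p ε
  exact ⟨hsub.lim, ge_of_tendsto' (hsub.tendsto_lim hbdd) fun k =>
    div_nonneg (groupLogCov_nonneg ρ p ε k) k.cast_nonneg, hsub.tendsto_lim hbdd,
    fun k hk => hsub.lim_le_div hbdd (by omega)⟩

theorem IsSoficApprox.exists_isOrbitDecomposition {d : ℕ → ℕ}
    {σ : ∀ i, Γ → Equiv.Perm (Fin (d i))} (hσ : IsSoficApprox d σ) :
    ∃ (k : ℕ → ℕ) (r : ∀ i, Fin (k i) → Fin (d i)), (∀ i, IsOrbitDecomposition (σ i) (r i)) ∧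
      Tendsto k atTop atTop ∧
      Tendsto (fun i => (k i : ℝ) / d i) atTop (𝓝 (1 / Fintype.card Γ)) := by
  choose k r hr using fun i => _root_.exists_isOrbitDecomposition (σ i)
  have hN : (0 : ℝ) < Fintype.card Γ := by exact_mod_cast Fintype.card_pos
  have hd : ∀ᶠ i in atTop, (0 : ℝ) < d i :=
    (hσ.tendsto_card.eventually_gt_atTop 0).mono fun i hi => by exact_mod_cast hi
  have hlim : Tendsto (fun i => (k i : ℝ) / d i) atTop (𝓝 (1 / Fintype.card Γ)) := by
    have h1 := (hσ.tendsto_card_not_isFreePoint.const_sub 1).div_const (Fintype.card Γ : ℝ)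
    rw [sub_zero] at h1
    refine h1.congr' (hd.mono fun i hi => ?_)
    have h2 := (hr i).card_eq
    field_simp
    linarith
  refine ⟨k, r, hr, ?_, hlim⟩
  have h1 : Tendsto (fun i => (k i : ℝ) / d i * d i) atTop atTop :=
    hlim.pos_mul_atTop (by positivity) (tendsto_natCast_atTop_atTop.comp hσ.tendsto_card)
  refine tendsto_natCast_atTop_iff (R := ℝ).1 (h1.congr' (hd.mono fun i hi => ?_))
  field_simp

variable (ρ : PseudoMetric X ℝ) {p : ℝ}
  {L : ℝ → ℝ} {d : ℕ → ℕ} {σ : ∀ i, Γ → Equiv.Perm (Fin (d i))}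

theorem IsSoficApprox.iInf_limsup_le (hρ : Continuous fun z : X × X => ρ z.1 z.2)
    (hσ : IsSoficApprox d σ) (hp : 1 ≤ p) {ε ℓ : ℝ}
    (hε : 0 < ε) (hε1 : ε < 1)
    (hL : Tendsto (fun k : ℕ => groupLogCov Γ ρ p (1 / 16 * ε) k / k) atTop (𝓝 ℓ)) :
    (⨅ (F : Finset Γ) (δ : ℝ) (_ : 0 < δ),
      limsup (fun i => logCoveringNum (lpDist ρ p) (soficMap ρ F δ (σ i)) ε /
        (((d i : ℝ) * Real.log (1 / ε) : ℝ) : EReal)) atTop) ≤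
      ((1 / Fintype.card Γ * (ℓ / Real.log (1 / ε)) : ℝ) : EReal) := by
  obtain ⟨D, hD, hρD⟩ := ρ.exists_forall_le hρ
  obtain ⟨k, r, hr, hk, hkd⟩ := hσ.exists_isOrbitDecomposition
  obtain ⟨δ, hδ, κ, hκ, hle⟩ := exists_coveringNum_soficMap_le (Γ := Γ) ρ hD hρD hp hε
  -- One pair is enough for the upper bound; as `Γ` is finite, all of it may serve as `F`.
  refine (iInf_le_of_le Finset.univ (iInf_le_of_le δ (iInf_le_of_le hδ le_rfl))).trans ?_
  rw [← (tendsto_groupLogCov_div_comp ρ hσ.tendsto_card hL hk hkd).limsup_eq]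
  refine limsup_le_limsup ?_
  have hlog : 0 < Real.log (1 / ε) := Real.log_pos (by rw [lt_div_iff₀ hε]; linarith)
  filter_upwards [hσ.tendsto_card_not_isFreePoint.eventually_lt_const hκ,
    hσ.tendsto_card.eventually_gt_atTop 0] with i h1 h2
  have h2' : (0 : ℝ) < d i := by exact_mod_cast h2
  rw [coe_groupLogCov ρ hρ (by linarith) (by positivity)]
  refine EReal.div_le_div_right_of_nonneg (EReal.coe_nonneg.2 (by positivity))
    (logCoveringNum_mono (hle _ _ _ _ h2 (hr i) ?_))
  exact ((div_lt_iff₀ h2').1 h1).le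

theorem IsSoficApprox.le_iInf_limsup (hρ : Continuous fun z : X × X => ρ z.1 z.2)
    (hσ : IsSoficApprox d σ) (hp : 1 ≤ p) {ε ℓ : ℝ}
    (hε : 0 < ε) (hε1 : ε < 1)
    (hL : Tendsto (fun k : ℕ => groupLogCov Γ ρ p (16 * ε) k / k) atTop (𝓝 ℓ)) :
    ((1 / Fintype.card Γ * (ℓ / Real.log (1 / ε)) : ℝ) : EReal) ≤
      ⨅ (F : Finset Γ) (δ : ℝ) (_ : 0 < δ),
        limsup (fun i => logCoveringNum (lpDist ρ p) (soficMap ρ F δ (σ i)) ε /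
          (((d i : ℝ) * Real.log (1 / ε) : ℝ) : EReal)) atTop := by
  obtain ⟨D, hD, hρD⟩ := ρ.exists_forall_le hρ
  obtain ⟨k, r, hr, hk, hkd⟩ := hσ.exists_isOrbitDecomposition
  refine le_iInf fun F => le_iInf fun δ => le_iInf fun hδ => ?_
  rw [← (tendsto_groupLogCov_div_comp ρ hσ.tendsto_card hL hk hkd).limsup_eq]
  refine limsup_le_limsup ?_
  have hlog : 0 < Real.log (1 / ε) := Real.log_pos (by rw [lt_div_iff₀ hε]; linarith)
  have hN : (0 : ℝ) < Fintype.card Γ := by exact_mod_cast Fintype.card_pos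
  have hκ : 0 < δ ^ (2 : ℝ) / D ^ (2 : ℝ) := by positivity
  filter_upwards [hσ.tendsto_card_not_isFreePoint.eventually_lt_const hκ,
    hσ.tendsto_card_not_isFreePoint.eventually_lt_const (by norm_num : (0 : ℝ) < 1 / 2),
    hσ.tendsto_card.eventually_gt_atTop 0] with i h1 h3 h2
  have h2' : (0 : ℝ) < d i := by exact_mod_cast h2
  rw [coe_groupLogCov ρ hρ (by linarith) (by positivity)]
  refine EReal.div_le_div_right_of_nonneg (EReal.coe_nonneg.2 (by positivity))
    (logCoveringNum_mono (coveringNum_le_coveringNum_soficMap ρ hρD hp hε hδ F h2 (hr i) ?_ ?_))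
  · rw [div_lt_div_iff₀ h2' (by positivity)] at h1
    linarith
  -- Fewer than half of the points are non-free, so the free orbits fill more than half of `d i`.
  · rw [div_lt_iff₀ h2'] at h3
    linarith [(hr i).card_eq]

theorem IsSoficApprox.soficMdim_eq (hρ : Continuous fun z : X × X => ρ z.1 z.2)
    (hσ : IsSoficApprox d σ) (hp : 1 ≤ p)
    (hL0 : ∀ ε, 0 < ε → 0 ≤ L ε)
    (hL : ∀ ε, 0 < ε → Tendsto (fun k : ℕ => groupLogCov Γ ρ p ε k / k) atTop (𝓝 (L ε))) :
    soficMdim ρ p d σ = ((1 / (Fintype.card Γ : ℝ) : ℝ) : EReal) *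
      liminf (fun ε : ℝ => ((L ε / Real.log (1 / ε) : ℝ) : EReal)) (𝓝[>] 0) := by
  have hN : (0 : ℝ) < 1 / Fintype.card Γ :=
    one_div_pos.2 (by exact_mod_cast Fintype.card_pos)
  have hev : ∀ᶠ ε : ℝ in 𝓝[>] 0, ε ∈ Set.Ioo (0 : ℝ) 1 := Ioo_mem_nhdsGT one_pos
  refine le_antisymm ?_ ?_
  · rw [← liminf_comp_const_mul_div_log hL0 hN (by norm_num : (0 : ℝ) < 1 / 16)]
    exact liminf_le_liminf (hev.mono fun ε hε =>
      hσ.iInf_limsup_le ρ hρ hp hε.1 hε.2 (hL _ (by linarith [hε.1])))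
  · rw [← liminf_comp_const_mul_div_log hL0 hN (by norm_num : (0 : ℝ) < 16)]
    exact liminf_le_liminf (hev.mono fun ε hε =>
      hσ.le_iInf_limsup ρ hρ hp hε.1 hε.2 (hL _ (by linarith [hε.1])))

end

theorem proposition2p11 {Γ : Type*} [Group Γ] [Fintype Γ]
    {X : Type*} [TopologicalSpace X] [CompactSpace X] [TopologicalSpace.MetrizableSpace X]
    [Nonempty X] [MulAction Γ X] [ContinuousConstSMul Γ X]
    (ρ : PseudoMetric X ℝ) (hρ : Continuous fun z : X × X => ρ z.1 z.2)
    (hgen : DynamicallyGenerating Γ ρ) (p : ℝ) (hp : 1 ≤ p) :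
    (∀ ε : ℝ, 0 < ε → ∃ L : ℝ,
      Tendsto (fun k : ℕ => logCoveringNum (groupLpDist Γ ρ p k) Set.univ ε / (k : EReal))
        atTop (𝓝 (L : EReal)) ∧
      (L : EReal) = ⨅ (k : ℕ) (_ : 1 ≤ k),
        logCoveringNum (groupLpDist Γ ρ p k) Set.univ ε / (k : EReal)) ∧
    ∃ Λ : ℝ → ℝ,
      (∀ ε : ℝ, 0 < ε → ε < 1 →
        Tendsto (fun k : ℕ => logCoveringNum (groupLpDist Γ ρ p k) Set.univ ε /
          (((k : ℝ) * Real.log (1 / ε) : ℝ) : EReal)) atTop (𝓝 (Λ ε : EReal))) ∧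
      IsMdim Γ ρ p
        (((1 / (Fintype.card Γ : ℝ) : ℝ) : EReal) *
          liminf (fun ε : ℝ => (Λ ε : EReal)) (𝓝[>] 0)) := by
  have hp0 : 0 < p := by linarith
  choose! L hL0 hL hLle using fun (ε : ℝ) (hε : 0 < ε) =>
    exists_tendsto_groupLogCov_div (Γ := Γ) ρ hρ hp0 hε
  -- The values of `Λ` at `ε ≥ 1` are irrelevant, since only the lower limit at 0 is taken.
  refine ⟨fun ε hε => ⟨L ε, ?_, ?_⟩, fun ε => L ε / Real.log (1 / ε), fun ε hε hε1 => ?_, ?_, ?_⟩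
  · simp only [← coe_groupLogCov ρ hρ hp0 hε, ← EReal.coe_coe_eq_natCast, ← EReal.coe_div]
    exact (continuous_coe_real_ereal.tendsto _).comp (hL ε hε)
  · simp only [← coe_groupLogCov ρ hρ hp0 hε, ← EReal.coe_coe_eq_natCast, ← EReal.coe_div]
    refine le_antisymm (le_iInf₂ fun k hk => EReal.coe_le_coe_iff.2 (hLle ε hε k hk)) ?_
    refine ge_of_tendsto ((continuous_coe_real_ereal.tendsto _).comp (hL ε hε)) ?_
    filter_upwards [eventually_ge_atTop 1] with k hk using iInf₂_le k hk
  · simp only [← coe_groupLogCov ρ hρ hp0 hε, ← EReal.coe_div]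
    refine (continuous_coe_real_ereal.tendsto _).comp (((hL ε hε).div_const _).congr fun k => ?_)
    rw [div_div]
  · exact exists_isSoficApprox Γ
  · exact fun d σ hσ => hσ.soficMdim_eq ρ hρ hp hL0 hL
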